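/- **Setting.** A \emph{connected Riemann surface $\Sigma$ with nodal boundary} is given by a compact, possibly disconnected, Riemann surface with boundary $\widetilde\Sigma$ (its normalization) together with a finite collection of disjoint unordered pairs of distinct points of $\partial\widetilde\Sigma$; $\Sigma$ is the (connected) quotient of $\widetilde\Sigma$ obtained by identifying the two points of each pair to a node. It carries $r$ labelled marked points on the boundary and $s$ labelled marked points in the interior, all distinct from each other and from the nodes. The double $C$ of $\Sigma$ is the nodal complex curve obtained by gluing $\Sigma$ and its complex conjugate along the boundary, with the $r+2s$ induced marked points; $\Sigma$ is \emph{stable} if $C$ has only finitely many automorphisms fixing the marked points. $\Sigma$ has $h$ boundary components if the smoothing of $\partial\Sigma$ (at each node, joining the boundary arc that enters along one branch to the arc that leaves along the other branch, with the boundary orientation) has $h$ connected components, and it then has genus $g$ if the arithmetic genus of $C$ is $2g-1+h$. An isomorphism of marked surfaces is a biholomorphic map of the normalizations that respects the pairs of points over the nodes and the labelled marked points. For integers $g,r,s\ge 0$ and $h>0$, $\overline{\mathcal N}_{g,h,r,s}$ is the moduli stack of stable such surfaces $\Sigma$ of genus $g$ with $h$ boundary components, $r$ boundary and $s$ interior marked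 points, and $D_{g,h,r,s}\subset\overline{\mathcal N}_{g,h,r,s}$ is the locus of surfaces all of whose irreducible components (connected components of $\widetilde\Sigma$) are discs with at most one interior marked point. For a topological space $T$, $\overline{\mathcal N}_{g,h,r,s}(T)$ (resp. $D_{g,h,r,s}(T)$) denotes the groupoid of continuous families over $T$ of such surfaces: proper separated maps $X\to T$ with continuous marked sections, which locally on $X$ are, by fibrewise holomorphic homeomorphisms, products of $T$ with an open subset of the closed upper half plane or, at nodes, of the form $\{(t,z,w): zw=f(t),\ \operatorname{Im}z\ge0,\ \operatorname{Im}w\ge0\}$ with $f\le 0$ continuous; isomorphisms are homeomorphisms over $T$ induced by fibrewise isomorphisms of marked surfaces. **Lemma.** Let $g,s\ge 0$, $h>0$ and $r\ge 1$. 1. Every $\Sigma\in\overline{\mathcal N}_{g,h,r,s}$ has no non-trivial automorphism fixing each of the marked points. 2. Consequently $\overline{\mathcal N}_{g,h,r,s}$ and $D_{g,h,r,s}$ have no stacky structure: for every topological space $T$, the canonical functor from the groupoid $\overline{\mathcal N}_{g,h,r,s}(T)$ to its set of isomorphism classes (a category with only identity morphisms) is an equivalence of categories, and likewise for $D_{g,h,r,s}(T)$.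 In other words, as categories fibred in groupoids over topological spaces, both are fibred in sets. -/

import Mathlib

open Set Filter Topology CategoryTheory
open scoped Manifold ContDiff ComplexConjugate

noncomputable section

/-! ### Riemann surfaces with boundary -/

/-- The closed upper half plane, the local model of a Riemann surface with boundary. -/
abbrev HalfPlane : Type := {z : ℂ // 0 ≤ z.im}

/-- The closed upper half plane as a complex model with corners: a manifold of class `ω` over this
model is a surface whose transition maps extend locally to holomorphic maps. -/
def halfPlaneModel : ModelWithCorners ℂ ℂ HalfPlane where
  toFun := Subtype.val
  invFun := fun z => ⟨⟨z.re, max z.im 0⟩, le_max_right _ _⟩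
  source := univ
  target := {z | 0 ≤ z.im}
  map_source' := fun z _ => z.2
  map_target' := fun _ _ => mem_univ _
  left_inv' := fun z _ => Subtype.ext (Complex.ext rfl (max_eq_left z.2))
  right_inv' := fun _ hz => Complex.ext rfl (max_eq_left hz)
  source_eq := rfl
  convex_range' := by
    have hr : range (Subtype.val : HalfPlane → ℂ) = {z : ℂ | 0 ≤ z.im} := Subtype.range_coe
    rw [dif_pos (inferInstance : IsRCLikeNormedField ℂ)]
    refine Convex.convex_isRCLikeNormedField ?_
    change Convex ℝ (range (Subtype.val : HalfPlane → ℂ))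
    rw [hr]
    exact convex_halfSpace_im_ge 0
  nonempty_interior' := by
    change (interior (range (Subtype.val : HalfPlane → ℂ))).Nonempty
    have hr : range (Subtype.val : HalfPlane → ℂ) = {z : ℂ | 0 ≤ z.im} := Subtype.range_coe
    rw [hr]
    refine ⟨Complex.I, mem_interior.2 ⟨{z | 0 < z.im}, fun z (hz : 0 < z.im) => hz.le, ?_, ?_⟩⟩
    · exact isOpen_lt continuous_const Complex.continuous_im
    · simp
  continuous_toFun := continuous_subtype_val
  continuous_invFun := by
    refine Continuous.subtype_mk ?_ _
    have h : (fun z : ℂ => (⟨z.re, max z.im 0⟩ : ℂ)) =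
        fun z : ℂ => ((z.re : ℂ) + ((max z.im 0 : ℝ) : ℂ) * Complex.I) := by
      funext z
      apply Complex.ext <;> simp
    rw [h]
    fun_prop

/-! ### Marked Riemann surfaces with boundary nodes -/

/-- A connected Riemann surface with boundary, with nodes on the boundary, with `r` marked points on
the boundary and `s` marked points in the interior, presented by its normalization:
`carrier` is a compact, possibly disconnected Riemann surface with boundary, and `nodes` is a finite
collection of disjoint unordered pairs of distinct boundary points of it. The surface itself is the
space obtained from `carrier` by identifying the two points of each pair (see
`MarkedSurface.Space`), and it is required to be connected. -/
structure MarkedSurface (r s : ℕ) where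
  carrier : Type
  [topology : TopologicalSpace carrier]
  [charted : ChartedSpace HalfPlane carrier]
  [isManifold : IsManifold halfPlaneModel ω carrier]
  [compact : CompactSpace carrier]
  [hausdorff : T2Space carrier]
  nodes : Set (Sym2 carrier)
  nodes_finite : nodes.Finite
  nodes_not_diag : ∀ e ∈ nodes, ¬ e.IsDiag
  nodes_boundary : ∀ e ∈ nodes, ∀ x ∈ e, x ∈ halfPlaneModel.boundary carrier
  nodes_disjoint : ∀ e ∈ nodes, ∀ e' ∈ nodes, ∀ x, x ∈ e → x ∈ e' → e = e'
  connected : ConnectedSpace (Quot fun x y : carrier => s(x, y) ∈ nodes)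
  /-- the marked points on the boundary -/
  bdryPt : Fin r → carrier
  bdryPt_injective : Function.Injective bdryPt
  bdryPt_mem : ∀ i, bdryPt i ∈ halfPlaneModel.boundary carrier
  bdryPt_not_node : ∀ i, ∀ e ∈ nodes, bdryPt i ∉ e
  /-- the marked points in the interior -/
  intPt : Fin s → carrier
  intPt_injective : Function.Injective intPt
  intPt_mem : ∀ j, intPt j ∈ halfPlaneModel.interior carrier

namespace MarkedSurface

attribute [instance] topology charted isManifold compact hausdorff

variable {r s : ℕ}

/-- The boundary of the normalization. -/
def bdry (S : MarkedSurface r s) : Set S.carrier := halfPlaneModel.boundary S.carrier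

/-- The points of the normalization which lie over the nodes. -/
def nodePts (S : MarkedSurface r s) : Set S.carrier := {x | ∃ e ∈ S.nodes, x ∈ e}

/-- The nodal surface itself: the two points of each pair in `nodes` are identified. -/
abbrev Space (S : MarkedSurface r s) : Type := Quot fun x y : S.carrier => s(x, y) ∈ S.nodes

/-- The projection from the normalization to the nodal surface. -/
def toSpace (S : MarkedSurface r s) (x : S.carrier) : S.Space := Quot.mk _ x

/-! ### Isomorphisms -/

/-- An isomorphism of marked surfaces: a biholomorphic map of the normalizations which matches the
nodes, and which carries each marked point to the marked point with the same label. -/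
structure SurfIso (S S' : MarkedSurface r s) where
  toDiffeo : Diffeomorph halfPlaneModel halfPlaneModel S.carrier S'.carrier ω
  map_nodes : ∀ e : Sym2 S.carrier, Sym2.map toDiffeo e ∈ S'.nodes ↔ e ∈ S.nodes
  map_bdryPt : ∀ i, toDiffeo (S.bdryPt i) = S'.bdryPt i
  map_intPt : ∀ j, toDiffeo (S.intPt j) = S'.intPt j

theorem SurfIso.ext_fun {S S' : MarkedSurface r s} {φ ψ : SurfIso S S'}
    (h : ∀ x, φ.toDiffeo x = ψ.toDiffeo x) : φ = ψ := by
  obtain ⟨d, _, _, _⟩ := φ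
  obtain ⟨d', _, _, _⟩ := ψ
  obtain rfl : d = d' := Diffeomorph.ext h
  rfl

/-- The identity automorphism. -/
def SurfIso.refl (S : MarkedSurface r s) : SurfIso S S where
  toDiffeo := Diffeomorph.refl _ _ _
  map_nodes e := by simp
  map_bdryPt _ := rfl
  map_intPt _ := rfl

/-- The inverse isomorphism. -/
def SurfIso.symm {S S' : MarkedSurface r s} (φ : SurfIso S S') : SurfIso S' S where
  toDiffeo := φ.toDiffeo.symm
  map_nodes e := by
    rw [← φ.map_nodes, Sym2.map_map]
    have : (φ.toDiffeo ∘ φ.toDiffeo.symm : S'.carrier → S'.carrier) = id := by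
      funext x
      simp
    rw [this, Sym2.map_id, id]
  map_bdryPt i := by rw [← φ.map_bdryPt]; simp
  map_intPt j := by rw [← φ.map_intPt]; simp

/-- The composite of two isomorphisms. -/
def SurfIso.trans {S S' S'' : MarkedSurface r s} (φ : SurfIso S S') (ψ : SurfIso S' S'') :
    SurfIso S S'' where
  toDiffeo := φ.toDiffeo.trans ψ.toDiffeo
  map_nodes e := by
    rw [← φ.map_nodes, ← ψ.map_nodes, Sym2.map_map]
    rfl
  map_bdryPt i := by
    change ψ.toDiffeo (φ.toDiffeo _) = _
    rw [φ.map_bdryPt, ψ.map_bdryPt]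
  map_intPt j := by
    change ψ.toDiffeo (φ.toDiffeo _) = _
    rw [φ.map_intPt, ψ.map_intPt]

/-- The map of nodal surfaces induced by an isomorphism. -/
def SurfIso.onSpace {S S' : MarkedSurface r s} (φ : SurfIso S S') : S.Space → S'.Space :=
  Quot.map φ.toDiffeo fun x y h => (φ.map_nodes s(x, y)).2 h

/-! ### The double -/

/-- The gluing of the surface to its mirror image along the boundary. -/
inductive DoubleRel (S : MarkedSurface r s) : S.carrier ⊕ S.carrier → S.carrier ⊕ S.carrier → Prop
  | glue (x : S.carrier) (hx : x ∈ S.bdry) : DoubleRel S (Sum.inl x) (Sum.inr x)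

/-- The double of the normalization, that is the normalization of the double. The first copy
carries the given complex structure, the second copy carries the conjugate one. -/
abbrev Double (S : MarkedSurface r s) : Type := Quot S.DoubleRel

/-- The points of the double. -/
def toDouble (S : MarkedSurface r s) (p : S.carrier ⊕ S.carrier) : S.Double := Quot.mk _ p

/-- The holomorphic parametrization of the double which is obtained from the chart of the surface
at `x` by reflection (meaningful on the chart's image and on its mirror image). -/
def doubleParam (S : MarkedSurface r s) (x : S.carrier) (w : ℂ) : S.Double :=
  if 0 ≤ w.im then S.toDouble (Sum.inl ((extChartAt halfPlaneModel x).symm w))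
  else S.toDouble (Sum.inr ((extChartAt halfPlaneModel x).symm (conj w)))

/-- The parameter, for `doubleParam`, of a point of the double. -/
def doubleCoord (S : MarkedSurface r s) : S.carrier ⊕ S.carrier → ℂ
  | Sum.inl x => extChartAt halfPlaneModel x x
  | Sum.inr x => conj (extChartAt halfPlaneModel x x)

/-- The point of the surface below a point of the double. -/
def fold (S : MarkedSurface r s) : S.carrier ⊕ S.carrier → S.carrier
  | Sum.inl x => x
  | Sum.inr x => x

/-- A self-map of the double is holomorphic if in the reflected charts it is given near each
point by a holomorphic function. -/
def DoubleHolomorphic (S : MarkedSurface r s) (f : S.Double → S.Double) : Prop :=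
  ∀ p q : S.carrier ⊕ S.carrier, f (S.toDouble p) = S.toDouble q →
    ∃ g : ℂ → ℂ, AnalyticAt ℂ g (S.doubleCoord p) ∧ g (S.doubleCoord p) = S.doubleCoord q ∧
      ∀ᶠ w in 𝓝 (S.doubleCoord p), f (S.doubleParam (S.fold p) w) = S.doubleParam (S.fold q) (g w)

/-- The nodes of the double. -/
def doubleNodes (S : MarkedSurface r s) : Set (Sym2 S.Double) :=
  Sym2.map (fun x => S.toDouble (Sum.inl x)) '' S.nodes

/-- The automorphisms of the double as a nodal complex curve with `r + 2 * s` marked points. -/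
def doubleAut (S : MarkedSurface r s) : Set (S.Double ≃ₜ S.Double) :=
  {f | S.DoubleHolomorphic f ∧ S.DoubleHolomorphic f.symm ∧
    Sym2.map f '' S.doubleNodes = S.doubleNodes ∧
    (∀ i, f (S.toDouble (Sum.inl (S.bdryPt i))) = S.toDouble (Sum.inl (S.bdryPt i))) ∧
    (∀ j, f (S.toDouble (Sum.inl (S.intPt j))) = S.toDouble (Sum.inl (S.intPt j))) ∧
    (∀ j, f (S.toDouble (Sum.inr (S.intPt j))) = S.toDouble (Sum.inr (S.intPt j)))}

/-- A surface is stable if its double has only finitely many automorphisms. -/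
def Stable (S : MarkedSurface r s) : Prop := S.doubleAut.Finite

/-! ### Genus and number of boundary components -/

/-- The sum of the genera of the components of the normalization of the double: half of its first
Betti number. -/
def doubleGeometricGenus (S : MarkedSurface r s) : ℕ :=
  Module.finrank ℚ (((AlgebraicTopology.singularHomologyFunctor (ModuleCat.{0} ℚ) 1).obj
    (ModuleCat.of ℚ ℚ)).obj (TopCat.of S.Double)) / 2

/-- The (arithmetic) genus of the double, a connected nodal curve: the sum of the genera of the
components of its normalization, plus the number of nodes, minus the number of these components,
plus one. -/
def doubleGenus (S : MarkedSurface r s) : ℤ :=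
  S.doubleGeometricGenus + S.nodes.ncard - Nat.card (ConnectedComponents S.Double) + 1

/-- The boundary of the normalization without the points over the nodes. -/
def freeBdry (S : MarkedSurface r s) : Set S.carrier := S.bdry \ S.nodePts

/-- The arc of `x` in the free boundary enters the point `a`, for the boundary orientation
(in a chart into the upper half plane: from left to right). -/
def ArcEnters (S : MarkedSurface r s) (x a : S.carrier) : Prop :=
  ∀ᶠ u : ℝ in 𝓝[<] (extChartAt halfPlaneModel a a).re,
    (extChartAt halfPlaneModel a).symm (u : ℂ) ∈ connectedComponentIn S.freeBdry x

/-- The arc of `x` in the free boundary leaves the point `a`, for the boundary orientation. -/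
def ArcLeaves (S : MarkedSurface r s) (x a : S.carrier) : Prop :=
  ∀ᶠ u : ℝ in 𝓝[>] (extChartAt halfPlaneModel a a).re,
    (extChartAt halfPlaneModel a).symm (u : ℂ) ∈ connectedComponentIn S.freeBdry x

/-- Two points of the free boundary are directly linked in the smoothing of the boundary if they lie
on the same arc, or if the arc of the first one enters a node along one branch and the arc of the
second one leaves this node along the other branch. -/
def SmoothingRel (S : MarkedSurface r s) (x y : S.freeBdry) : Prop :=
  (y : S.carrier) ∈ connectedComponentIn S.freeBdry x ∨
    ∃ a b : S.carrier, s(a, b) ∈ S.nodes ∧ S.ArcEnters x a ∧ S.ArcLeaves y b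

/-- The number of boundary components: the number of connected components of the smoothing of the
boundary. -/
def boundaryCount (S : MarkedSurface r s) : ℕ := Nat.card (Quot S.SmoothingRel)

/-! ### The surfaces which are parametrized by the moduli spaces -/

/-- Stable surfaces of genus `g` with `h` boundary components. -/
def InNbar (g h : ℕ) (S : MarkedSurface r s) : Prop :=
  S.Stable ∧ S.boundaryCount = h ∧ S.doubleGenus = 2 * (g : ℤ) - 1 + h

/-- Those whose irreducible components are all discs with at most one interior marked point. -/
def InD (g h : ℕ) (S : MarkedSurface r s) : Prop :=
  S.InNbar g h ∧ ∀ x : S.carrier,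
    Nonempty (connectedComponent x ≃ₜ Metric.closedBall (0 : ℂ) 1) ∧
      ∀ i j, S.intPt i ∈ connectedComponent x → S.intPt j ∈ connectedComponent x → i = j

/-! ### Families over a topological space, and the moduli stacks -/

/-- The points of the total space of a family of nodal surfaces. -/
structure Total {T : Type} (F : T → MarkedSurface r s) where
  base : T
  pt : (F base).Space

section Charts

variable {T : Type} [TopologicalSpace T] (F : T → MarkedSurface r s) [TopologicalSpace (Total F)]

/-- Near `x` the family is a product of an open set of the base and an open set of the half plane,
by a map which is holomorphic on the fibres and avoids the nodes. -/
def RegularChartAt (x : Total F) : Prop :=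
  ∃ (U : Set T) (B : Set HalfPlane) (ψ : ∀ t, HalfPlane → (F t).carrier),
    IsOpen U ∧ IsOpen B ∧
    (∀ t ∈ U, ContMDiffOn halfPlaneModel halfPlaneModel ω (ψ t) B) ∧
    (∀ t ∈ U, ∀ z ∈ B, ψ t z ∉ (F t).nodePts) ∧
    IsOpenEmbedding (fun p : U × B => (⟨p.1, (F p.1).toSpace (ψ p.1 p.2)⟩ : Total F)) ∧
    ∃ p : U × B, (⟨p.1, (F p.1).toSpace (ψ p.1 p.2)⟩ : Total F) = x

/-- The local model at a node: the fibre over `t` is `{z w = f t}` in the product of two half discs,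
with `f ≤ 0`. It has a node where `f` vanishes, and is smooth elsewhere. -/
def plumbing (U : Set T) (f : T → ℝ) (ε : ℝ) : Set (T × HalfPlane × HalfPlane) :=
  {p | p.1 ∈ U ∧ ‖(p.2.1 : ℂ)‖ < ε ∧ ‖(p.2.2 : ℂ)‖ < ε ∧ (p.2.1 : ℂ) * p.2.2 = (f p.1 : ℂ)}

/-- Near the node `x` the family is isomorphic to a model `plumbing`, by a map which is holomorphic
on the fibres. -/
def NodeChartAt (x : Total F) : Prop :=
  ∃ (U : Set T) (f : T → ℝ) (ε : ℝ) (Ψ : plumbing U f ε → Total F),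
    IsOpen U ∧ ContinuousOn f U ∧ (∀ t ∈ U, f t ≤ 0) ∧ 0 < ε ∧
    IsOpenEmbedding Ψ ∧ (∀ p, (Ψ p).base = p.1.1) ∧
    (∃ p, (p.1.2.1 : ℂ) = 0 ∧ (p.1.2.2 : ℂ) = 0 ∧ Ψ p = x) ∧
    (∀ t ∈ U, f t < 0 → ∃ σ : HalfPlane → (F t).carrier,
      ContMDiffOn halfPlaneModel halfPlaneModel ω σ
        {z | ‖(z : ℂ)‖ < ε ∧ -f t < ε * ‖(z : ℂ)‖} ∧
      ∀ (z w : HalfPlane) (hp : (t, z, w) ∈ plumbing U f ε),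
        σ z ∉ (F t).nodePts ∧ Ψ ⟨(t, z, w), hp⟩ = ⟨t, (F t).toSpace (σ z)⟩) ∧
    (∀ t ∈ U, f t = 0 → ∃ α β : HalfPlane → (F t).carrier,
      ContMDiffOn halfPlaneModel halfPlaneModel ω α {z | ‖(z : ℂ)‖ < ε} ∧
      ContMDiffOn halfPlaneModel halfPlaneModel ω β {z | ‖(z : ℂ)‖ < ε} ∧
      s(α ⟨0, le_rfl⟩, β ⟨0, le_rfl⟩) ∈ (F t).nodes ∧
      (∀ (z : HalfPlane) (hp : (t, z, ⟨0, le_rfl⟩) ∈ plumbing U f ε),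
        Ψ ⟨(t, z, ⟨0, le_rfl⟩), hp⟩ = ⟨t, (F t).toSpace (α z)⟩) ∧
      (∀ (w : HalfPlane) (hp : (t, ⟨0, le_rfl⟩, w) ∈ plumbing U f ε),
        Ψ ⟨(t, ⟨0, le_rfl⟩, w), hp⟩ = ⟨t, (F t).toSpace (β w)⟩))

end Charts

/-- A continuous family over `T` of connected marked surfaces with boundary nodes which all have
the property `P`. -/
structure Family (T : Type) [TopologicalSpace T] (P : MarkedSurface r s → Prop) where
  fib : T → MarkedSurface r s
  fib_mem : ∀ t, P (fib t)
  [topTotal : TopologicalSpace (Total fib)]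
  isProper : IsProperMap (Total.base : Total fib → T)
  isSeparated : IsSeparatedMap (Total.base : Total fib → T)
  fib_embedding : ∀ t, IsEmbedding (fun x : (fib t).Space => (⟨t, x⟩ : Total fib))
  exists_chart : ∀ x : Total fib, RegularChartAt fib x ∨ NodeChartAt fib x
  continuous_bdryPt : ∀ i,
    Continuous fun t => (⟨t, (fib t).toSpace ((fib t).bdryPt i)⟩ : Total fib)
  continuous_intPt : ∀ j,
    Continuous fun t => (⟨t, (fib t).toSpace ((fib t).intPt j)⟩ : Total fib)

attribute [instance] Family.topTotal

section Moduli

variable {T : Type} [TopologicalSpace T] {P : MarkedSurface r s → Prop}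

/-- An isomorphism of families over `T`: isomorphisms of the fibres which together form a
homeomorphism of the total spaces. -/
structure FamilyIso (F G : Family T P) where
  onFib : ∀ t, SurfIso (F.fib t) (G.fib t)
  continuous_toFun :
    Continuous fun x : Total F.fib => (⟨x.base, (onFib x.base).onSpace x.pt⟩ : Total G.fib)
  continuous_invFun :
    Continuous fun x : Total G.fib => (⟨x.base, (onFib x.base).symm.onSpace x.pt⟩ : Total F.fib)

theorem FamilyIso.ext_onFib {F G : Family T P} {φ ψ : FamilyIso F G}
    (h : ∀ t, φ.onFib t = ψ.onFib t) : φ = ψ := by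
  obtain ⟨a, _, _⟩ := φ
  obtain ⟨b, _, _⟩ := ψ
  obtain rfl : a = b := funext h
  rfl

theorem SurfIso.onSpace_refl {S : MarkedSurface r s} (x : S.Space) :
    (SurfIso.refl S).onSpace x = x := by
  induction x using Quot.ind
  rfl

theorem SurfIso.onSpace_trans {S S' S'' : MarkedSurface r s} (φ : SurfIso S S')
    (ψ : SurfIso S' S'') (x : S.Space) : (φ.trans ψ).onSpace x = ψ.onSpace (φ.onSpace x) := by
  induction x using Quot.ind
  rfl

/-- The groupoid of families over `T`. -/
instance Family.groupoid : Groupoid (Family T P) where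
  Hom F G := FamilyIso F G
  id F :=
    { onFib := fun t => SurfIso.refl _
      continuous_toFun := by
        simp only [SurfIso.onSpace_refl]
        exact continuous_id
      continuous_invFun := by
        have h : ∀ t, (SurfIso.refl (F.fib t)).symm = SurfIso.refl (F.fib t) := fun t =>
          SurfIso.ext_fun fun _ => rfl
        simp only [h, SurfIso.onSpace_refl]
        exact continuous_id }
  comp {F G K} φ ψ :=
    { onFib := fun t => (φ.onFib t).trans (ψ.onFib t)
      continuous_toFun := by
        simpa [SurfIso.onSpace_trans, Function.comp_def] using
          ψ.continuous_toFun.comp φ.continuous_toFun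
      continuous_invFun := by
        have h : ∀ t, ((φ.onFib t).trans (ψ.onFib t)).symm =
            (ψ.onFib t).symm.trans (φ.onFib t).symm := fun t => SurfIso.ext_fun fun _ => rfl
        simpa [h, SurfIso.onSpace_trans, Function.comp_def] using
          φ.continuous_invFun.comp ψ.continuous_invFun }
  inv {F G} φ :=
    { onFib := fun t => (φ.onFib t).symm
      continuous_toFun := φ.continuous_invFun
      continuous_invFun := by
        have h : ∀ t, ((φ.onFib t).symm).symm = φ.onFib t := fun t => SurfIso.ext_fun fun _ => rfl
        simpa [h] using φ.continuous_toFun }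
  id_comp φ := FamilyIso.ext_onFib fun t => SurfIso.ext_fun fun x => rfl
  comp_id φ := FamilyIso.ext_onFib fun t => SurfIso.ext_fun fun x => rfl
  assoc φ ψ χ := FamilyIso.ext_onFib fun t => SurfIso.ext_fun fun x => rfl
  inv_comp φ := FamilyIso.ext_onFib fun t => SurfIso.ext_fun fun x =>
    (φ.onFib t).toDiffeo.apply_symm_apply x
  comp_inv φ := FamilyIso.ext_onFib fun t => SurfIso.ext_fun fun x =>
    (φ.onFib t).toDiffeo.symm_apply_apply x

end Moduli

/-- The value at `T` of the moduli stack: stable marked surfaces of type `(g, h, r, s)`,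
parametrized by `T`, and their isomorphisms. -/
abbrev Nbar (g h r s : ℕ) (T : Type) [TopologicalSpace T] : Type 1 :=
  Family T fun S : MarkedSurface r s => S.InNbar g h

/-- The value at `T` of the substack of surfaces made of discs with at most one interior marked
point. -/
abbrev DSpace (g h r s : ℕ) (T : Type) [TopologicalSpace T] : Type 1 :=
  Family T fun S : MarkedSurface r s => S.InD g h

end MarkedSurface

/-- The functor from a groupoid to its set of isomorphism classes. -/
def toIsoClasses (C : Type*) [Groupoid C] : C ⥤ Discrete (Quotient (isIsomorphicSetoid C)) where
  obj X := ⟨Quotient.mk _ X⟩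
  map f := Discrete.eqToHom (Quotient.sound ⟨asIso f⟩)

end

/-!
An automorphism `φ` of a stable surface acts on the double, by reflection across the boundary, and
this action is faithful (`MarkedSurface.SurfIso.doubleHomeo_injective`). That it is holomorphic
across the boundary is Schwarz reflection (`MarkedSurface.SurfIso.doubleHolomorphic`). Since the
double has only finitely many automorphisms, `φ` has finite order
(`MarkedSurface.Stable.exists_iterate_eq_id`).

Let `x` be a boundary point fixed by `φ`. In a half-plane chart `φ` is a holomorphic germ `g` that
fixes a real point and preserves the upper half plane, so its derivative there is real and
nonnegative; as a root of unity it equals `1`. The sum of the iterates of `g` is then a local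
coordinate invariant under `g`, so `g` is the identity
(`Diffeomorph.eventuallyEq_id_of_iterate`).

By the identity theorem the set of points near which `φ` is the identity is clopen
(`Diffeomorph.isClopen_eventuallyEq_id`). It contains a marked boundary point. If it contains one of
the two points over a node, then `φ`, which permutes the pairs over the nodes, fixes the other point
too, and this is again a fixed boundary point. As the nodal surface is connected, `φ` is the identity
(`MarkedSurface.Stable.eq_refl`). Two isomorphisms of families with the same source and target
therefore agree on each fibre, and a groupoid whose morphism sets have at most one element is
equivalent to its set of isomorphism classes.
-/

/-! ### Holomorphic germs on the half plane -/

theorem tendsto_add_ofReal_mul_nhdsNE (c : ℂ) {v : ℂ} (hv : v ≠ 0) :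
    Tendsto (fun t : ℝ => c + t * v) (𝓝[>] 0) (𝓝[≠] c) := by
  refine tendsto_nhdsWithin_iff.2 ⟨?_, ?_⟩
  · have h : Continuous fun t : ℝ => c + t * v := by fun_prop
    simpa using (h.tendsto 0).mono_left nhdsWithin_le_nhds
  · filter_upwards [self_mem_nhdsWithin] with t ht
    simpa using ⟨ne_of_gt ht, hv⟩

/-- Two analytic germs that agree along a ray are equal. -/
theorem AnalyticAt.eventuallyEq_of_ray {f g : ℂ → ℂ} {c v : ℂ} (hf : AnalyticAt ℂ f c)
    (hg : AnalyticAt ℂ g c) (hv : v ≠ 0)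
    (h : ∀ᶠ t : ℝ in 𝓝[>] 0, f (c + t * v) = g (c + t * v)) : f =ᶠ[𝓝 c] g :=
  (hf.frequently_eq_iff_eventually_eq hg).1
    ((tendsto_add_ofReal_mul_nhdsNE c hv).frequently h.frequently)

theorem AnalyticAt.eventuallyEq_of_halfPlane {f g : ℂ → ℂ} {c : ℂ} (hf : AnalyticAt ℂ f c)
    (hg : AnalyticAt ℂ g c) (hc : 0 ≤ c.im) (h : ∀ᶠ z in 𝓝 c, 0 ≤ z.im → f z = g z) :
    f =ᶠ[𝓝 c] g := by
  refine hf.eventuallyEq_of_ray hg Complex.I_ne_zero ?_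
  filter_upwards [((tendsto_add_ofReal_mul_nhdsNE c Complex.I_ne_zero).mono_right
    nhdsWithin_le_nhds).eventually h, self_mem_nhdsWithin] with t ht ht0
  refine ht ?_
  have : 0 < t := ht0
  simp
  positivity

theorem AnalyticAt.conj_conj {g : ℂ → ℂ} {c : ℂ} (hg : AnalyticAt ℂ g (conj c)) :
    AnalyticAt ℂ (fun z => conj (g (conj z))) c := by
  rw [Complex.analyticAt_iff_eventually_differentiableAt] at hg ⊢
  filter_upwards [Complex.continuous_conj.continuousAt.eventually hg] with z hz
  simpa [Function.comp_def] using hz.conj_conj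

/-- The Schwarz reflection principle: an analytic germ at a real point that is real on the real line
commutes with conjugation. -/
theorem AnalyticAt.eventually_map_conj {g : ℂ → ℂ} {c : ℂ} (hg : AnalyticAt ℂ g c)
    (hc : c.im = 0) (h : ∀ᶠ z in 𝓝 c, z.im = 0 → (g z).im = 0) :
    ∀ᶠ z in 𝓝 c, g z = conj (g (conj z)) := by
  have hcc : conj c = c := Complex.conj_eq_iff_im.2 hc
  have hk : AnalyticAt ℂ (fun z => conj (g (conj z))) c := AnalyticAt.conj_conj (by rwa [hcc])
  refine hg.eventuallyEq_of_ray hk one_ne_zero ?_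
  filter_upwards [((tendsto_add_ofReal_mul_nhdsNE c one_ne_zero).mono_right
    nhdsWithin_le_nhds).eventually h] with t ht
  have h0 : (c + t * 1).im = 0 := by simp [hc]
  rw [Complex.conj_eq_iff_im.2 h0, Complex.conj_eq_iff_im.2 (ht h0)]

/-- A germ of finite order with derivative `1` at its fixed point is the identity: the sum `h` of its
iterates satisfies `h ∘ g = h` and is locally injective. -/
theorem HasStrictDerivAt.eventuallyEq_id_of_iterate {g : ℂ → ℂ} {c : ℂ} {n : ℕ} (hn : n ≠ 0)
    (hg : HasStrictDerivAt g 1 c) (hc : g c = c) (hit : g^[n] =ᶠ[𝓝 c] id) : g =ᶠ[𝓝 c] id := by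
  let h : ℂ → ℂ := fun z => ∑ k ∈ Finset.range n, g^[k] z
  have hh : HasStrictDerivAt h (∑ k ∈ Finset.range n, (1 : ℂ) ^ k) c :=
    HasStrictDerivAt.fun_sum fun k _ => HasStrictDerivAt.iterate _ hg hc k
  have h0 : (∑ k ∈ Finset.range n, (1 : ℂ) ^ k) ≠ 0 := by simpa using hn
  have hinv := hh.eventually_left_inverse h0
  have hgc : Tendsto g (𝓝 c) (𝓝 c) := by simpa [hc] using hg.hasDerivAt.continuousAt.tendsto
  filter_upwards [hinv, hgc.eventually hinv, hit] with z h1 h2 h3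
  have : h (g z) = h z := by
    have := Finset.sum_range_succ (fun k => g^[k] z) n
    rw [Finset.sum_range_succ'] at this
    simpa [h, h3] using this
  rw [id, ← h2, this, h1]

/-- The derivative at a real fixed point of a germ preserving the half plane is real and
nonnegative. -/
theorem HasDerivAt.exists_nonneg_of_halfPlane {g : ℂ → ℂ} {c l : ℂ} (hg : HasDerivAt g l c)
    (hc : c.im = 0) (hgc : g c = c) (hm : ∀ᶠ z in 𝓝 c, 0 ≤ z.im → 0 ≤ (g z).im) :
    ∃ a : ℝ, 0 ≤ a ∧ l = a := by
  -- the derivative preserves the half plane, which is the tangent cone of itself at `c`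
  have key : ∀ v : ℂ, v ≠ 0 → 0 ≤ v.im → 0 ≤ (l * v).im := by
    intro v hv0 hv
    have hline : HasDerivAt (fun t : ℝ => c + t * v) v 0 := by
      simpa using ((Complex.ofRealCLM.hasDerivAt (x := (0 : ℝ))).mul_const v).const_add c
    have hcomp : HasDerivAt (fun t : ℝ => g (c + t * v)) (l * v) 0 := by
      have hg' : HasDerivAt g l (c + ((0 : ℝ) : ℂ) * v) := by simpa using hg
      exact hg'.comp (0 : ℝ) hline
    have hlim := (Complex.continuous_im.tendsto _).comp hcomp.tendsto_slope_zero_right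
    refine ge_of_tendsto hlim ?_
    filter_upwards [((tendsto_add_ofReal_mul_nhdsNE c hv0).mono_right
      nhdsWithin_le_nhds).eventually hm, self_mem_nhdsWithin] with t ht ht0
    have ht0 : 0 < t := ht0
    have h1 : 0 ≤ (g (c + t * v)).im := ht (by simp [hc]; positivity)
    simp only [Function.comp_apply, zero_add, Complex.ofReal_zero, zero_mul, add_zero, hgc,
      Complex.smul_im, Complex.sub_im, hc, sub_zero, smul_eq_mul]
    positivity
  have h1 := key 1 one_ne_zero (by simp)
  have h2 := key (-1) (by simp) (by simp)
  have h3 := key Complex.I Complex.I_ne_zero (by simp)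
  simp at h1 h2 h3
  exact ⟨l.re, h3, Complex.ext rfl (by simpa using le_antisymm h2 h1)⟩

/-- A germ of finite order at a real fixed point that preserves the half plane is the identity. -/
theorem AnalyticAt.eventuallyEq_id_of_iterate {g : ℂ → ℂ} {c : ℂ} {n : ℕ} (hn : n ≠ 0)
    (hg : AnalyticAt ℂ g c) (hc : c.im = 0) (hgc : g c = c)
    (hm : ∀ᶠ z in 𝓝 c, 0 ≤ z.im → 0 ≤ (g z).im) (hit : g^[n] =ᶠ[𝓝 c] id) : g =ᶠ[𝓝 c] id := by
  have hd := hg.hasStrictDerivAt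
  obtain ⟨a, ha, hla⟩ := hd.hasDerivAt.exists_nonneg_of_halfPlane hc hgc hm
  rw [hla] at hd
  have hpow : (a : ℂ) ^ n = 1 :=
    (HasDerivAt.iterate _ hd.hasDerivAt hgc n).unique ((hasDerivAt_id c).congr_of_eventuallyEq hit)
  have ha1 : a = 1 := (pow_eq_one_iff_of_nonneg ha hn).1 (by exact_mod_cast hpow)
  rw [ha1, Complex.ofReal_one] at hd
  exact hd.eventuallyEq_id_of_iterate hn hgc hit

/-! ### Holomorphic maps of surfaces with boundary in charts -/

section Surface

local notation "𝓗" => halfPlaneModel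

theorem range_halfPlaneModel : range 𝓗 = {z : ℂ | 0 ≤ z.im} :=
  Subtype.range_coe

variable {M N : Type*} [TopologicalSpace M] [ChartedSpace HalfPlane M]
  [TopologicalSpace N] [ChartedSpace HalfPlane N]

theorem im_nonneg_of_mem_target {x : M} {z : ℂ} (hz : z ∈ (extChartAt 𝓗 x).target) :
    0 ≤ z.im := by
  have := extChartAt_target_subset_range x hz
  rwa [range_halfPlaneModel] at this

theorem im_extChartAt_self_nonneg (x : M) : 0 ≤ (extChartAt 𝓗 x x).im :=
  im_nonneg_of_mem_target (mem_extChartAt_target x)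

theorem eventually_mem_extChartAt_target (x : M) :
    ∀ᶠ z in 𝓝 (extChartAt 𝓗 x x), 0 ≤ z.im → z ∈ (extChartAt 𝓗 x).target := by
  have := extChartAt_target_mem_nhdsWithin (I := 𝓗) x
  rw [range_halfPlaneModel] at this
  exact eventually_nhdsWithin_iff.1 this

/-- In any chart, the interior points are those with positive imaginary part. -/
theorem isInteriorPoint_symm_iff [IsManifold 𝓗 ω M] {x : M} {z : ℂ}
    (hz : z ∈ (extChartAt 𝓗 x).target) :
    (extChartAt 𝓗 x).symm z ∈ (𝓗).interior M ↔ 0 < z.im := by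
  have hs : (extChartAt 𝓗 x).symm z ∈ (chartAt HalfPlane x).source := by
    simpa only [extChartAt_source] using (extChartAt 𝓗 x).map_target hz
  have key : (extChartAt 𝓗 x).symm z ∈ (𝓗).interior M ↔
      z ∈ interior (extChartAt 𝓗 x).target := by
    refine ((𝓗).isInteriorPoint_iff_of_mem_atlas (n := ω) (by simp)
      (chart_mem_atlas HalfPlane x) hs).trans ?_
    change extChartAt 𝓗 x ((extChartAt 𝓗 x).symm z) ∈ interior (extChartAt 𝓗 x).target ↔ _
    rw [(extChartAt 𝓗 x).right_inv hz]
  rw [key]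
  constructor
  · intro h
    have := interior_mono (extChartAt_target_subset_range x) h
    rwa [range_halfPlaneModel, Complex.interior_setOfPred_le_im] at this
  · intro h
    rw [mem_interior_iff_mem_nhds]
    have h1 := extChartAt_target_mem_nhdsWithin_of_mem hz
    rwa [nhdsWithin_eq_nhds.2] at h1
    rw [range_halfPlaneModel]
    filter_upwards [(isOpen_lt continuous_const Complex.continuous_im).mem_nhds h] with w hw
      using le_of_lt hw

theorem mem_interior_iff_im_pos (x : M) :
    x ∈ (𝓗).interior M ↔ 0 < (extChartAt 𝓗 x x).im := by
  change extChartAt 𝓗 x x ∈ interior (range 𝓗) ↔ _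
  rw [range_halfPlaneModel, Complex.interior_setOfPred_le_im]
  rfl

theorem mem_boundary_iff_im_eq_zero (x : M) :
    x ∈ (𝓗).boundary M ↔ (extChartAt 𝓗 x x).im = 0 := by
  rw [← ModelWithCorners.compl_interior, mem_compl_iff, mem_interior_iff_im_pos, not_lt]
  exact ⟨fun h => le_antisymm h (im_extChartAt_self_nonneg x), fun h => h.le⟩

/-- A diffeomorphism of class `ω` is given in charts, on the half plane, by a germ that is analytic
on a neighbourhood in the whole plane. -/
theorem Diffeomorph.exists_analyticAt_extChartAt (φ : Diffeomorph 𝓗 𝓗 M N ω) (x : M) :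
    ∃ g : ℂ → ℂ, AnalyticAt ℂ g (extChartAt 𝓗 x x) ∧
      g (extChartAt 𝓗 x x) = extChartAt 𝓗 (φ x) (φ x) ∧
      ∀ᶠ z in 𝓝 (extChartAt 𝓗 x x), 0 ≤ z.im →
        z ∈ (extChartAt 𝓗 x).target ∧ g z ∈ (extChartAt 𝓗 (φ x)).target ∧
          φ ((extChartAt 𝓗 x).symm z) = (extChartAt 𝓗 (φ x)).symm (g z) := by
  have h1 := (contMDiffAt_iff.1 (φ.contMDiff x)).2
  obtain ⟨g, h0, hg, hga⟩ := h1.analyticWithinAt.exists_analyticAt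
  simp only [Function.comp_apply, extChartAt_to_inv] at h0
  refine ⟨g, hga, h0.symm, ?_⟩
  have hcont : ContinuousAt (fun z => φ ((extChartAt 𝓗 x).symm z)) (extChartAt 𝓗 x x) :=
    φ.continuous.continuousAt.comp (continuousAt_extChartAt_symm x)
  have hsrc := hcont.preimage_mem_nhds (by
    simpa only [extChartAt_to_inv] using extChartAt_source_mem_nhds (I := 𝓗) (φ x))
  filter_upwards [eventually_mem_extChartAt_target x, hsrc] with z hz hz' hpos
  have hgz : extChartAt 𝓗 (φ x) (φ ((extChartAt 𝓗 x).symm z)) = g z :=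
    hg (mem_insert_of_mem _ (by rw [range_halfPlaneModel]; exact hpos))
  rw [← hgz]
  exact ⟨hz hpos, (extChartAt 𝓗 (φ x)).map_source hz', ((extChartAt 𝓗 (φ x)).left_inv hz').symm⟩

theorem Diffeomorph.mem_interior_iff [IsManifold 𝓗 ω M] [IsManifold 𝓗 ω N]
    (φ : Diffeomorph 𝓗 𝓗 M N ω) (x : M) : φ x ∈ (𝓗).interior N ↔ x ∈ (𝓗).interior M := by
  rw [← φ.preimage_interior (by simp), mem_preimage]

theorem Diffeomorph.mem_boundary_iff [IsManifold 𝓗 ω M] [IsManifold 𝓗 ω N]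
    (φ : Diffeomorph 𝓗 𝓗 M N ω) (x : M) : φ x ∈ (𝓗).boundary N ↔ x ∈ (𝓗).boundary M := by
  rw [← φ.preimage_boundary (by simp), mem_preimage]

/-- An equality of germs on the half plane, read off in a chart of the surface. -/
theorem eventually_of_extChartAt {x : M} {p : M → Prop}
    (h : ∀ᶠ z in 𝓝 (extChartAt 𝓗 x x), 0 ≤ z.im → p ((extChartAt 𝓗 x).symm z)) :
    ∀ᶠ y in 𝓝 x, p y := by
  filter_upwards [(continuousAt_extChartAt (I := 𝓗) x).eventually h,
    extChartAt_source_mem_nhds (I := 𝓗) x] with y hy hs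
  have := hy (im_nonneg_of_mem_target ((extChartAt 𝓗 x).map_source hs))
  rwa [(extChartAt 𝓗 x).left_inv hs] at this

/-- A biholomorphic self-map of finite order is the identity near a fixed boundary point. -/
theorem Diffeomorph.eventuallyEq_id_of_iterate (φ : Diffeomorph 𝓗 𝓗 M M ω) {n : ℕ} (hn : n ≠ 0)
    (hφ : φ^[n] = id) {x : M} (hx : x ∈ (𝓗).boundary M) (hfix : φ x = x) : φ =ᶠ[𝓝 x] id := by
  obtain ⟨g, hg, hgc, hev⟩ := φ.exists_analyticAt_extChartAt x
  rw [hfix] at hgc hev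
  set c := extChartAt 𝓗 x x with hcdef
  have hc : c.im = 0 := (mem_boundary_iff_im_eq_zero x).1 hx
  have hgk : ∀ k, AnalyticAt ℂ g^[k] c ∧ g^[k] c = c := by
    intro k
    induction k with
    | zero => exact ⟨analyticAt_id, rfl⟩
    | succ k ih =>
      refine ⟨?_, by rw [Function.iterate_succ_apply', ih.2, hgc]⟩
      rw [Function.iterate_succ']
      exact AnalyticAt.comp (by rwa [ih.2]) ih.1
  have hiter : ∀ k, ∀ᶠ z in 𝓝 c, 0 ≤ z.im → g^[k] z ∈ (extChartAt 𝓗 x).target ∧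
      φ^[k] ((extChartAt 𝓗 x).symm z) = (extChartAt 𝓗 x).symm (g^[k] z) := by
    intro k
    induction k with
    | zero => filter_upwards [hev] with z hz h0 using ⟨(hz h0).1, rfl⟩
    | succ k ih =>
      have ht : Tendsto g^[k] (𝓝 c) (𝓝 c) := by
        simpa [(hgk k).2] using (hgk k).1.continuousAt.tendsto
      filter_upwards [ih, ht.eventually hev] with z h1 h2 h0
      obtain ⟨h3, h4⟩ := h1 h0
      obtain ⟨-, h5, h6⟩ := h2 (im_nonneg_of_mem_target h3)
      rw [Function.iterate_succ_apply', Function.iterate_succ_apply', h4]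
      exact ⟨h5, h6⟩
  have hid : g =ᶠ[𝓝 c] id := by
    refine hg.eventuallyEq_id_of_iterate hn hc hgc ?_ ?_
    · filter_upwards [hev] with z hz h0 using im_nonneg_of_mem_target (hz h0).2.1
    · refine (hgk n).1.eventuallyEq_of_halfPlane analyticAt_id hc.ge ?_
      filter_upwards [hiter n, hev] with z hz hz' h0
      obtain ⟨h1, h2⟩ := hz h0
      rw [hφ] at h2
      exact ((extChartAt 𝓗 x).symm.injOn (hz' h0).1 h1 h2).symm
  refine eventually_of_extChartAt (p := fun y => φ y = id y) ?_
  filter_upwards [hev, hid] with z hz hz' h0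
  rw [(hz h0).2.2, hz', id, id]

/-- The identity theorem for self-maps of a surface. -/
theorem Diffeomorph.isClopen_eventuallyEq_id [T2Space M] (φ : Diffeomorph 𝓗 𝓗 M M ω) :
    IsClopen {x | φ =ᶠ[𝓝 x] id} := by
  refine ⟨isClosed_of_closure_subset fun x hx => ?_, isOpen_setOfPred_eventually_nhds⟩
  have hfix : φ x = x := by
    have hcl : IsClosed {y | φ y = y} := isClosed_eq φ.continuous continuous_id
    exact closure_minimal (fun y hy => hy.self_of_nhds) hcl hx
  obtain ⟨g, hg, -, hev⟩ := φ.exists_analyticAt_extChartAt x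
  rw [hfix] at hev
  set c := extChartAt 𝓗 x x with hcdef
  obtain ⟨r, hr, hball⟩ := Metric.eventually_nhds_iff_ball.1 (hg.eventually_analyticAt.and hev)
  -- a point near `x` about which `φ` is the identity; in the chart, `g` is the identity on the
  -- half plane about its image
  have hnear : ∀ᶠ y in 𝓝 x, extChartAt 𝓗 x y ∈ Metric.ball c r ∧ y ∈ (extChartAt 𝓗 x).source :=
    ((continuousAt_extChartAt (I := 𝓗) x).eventually (Metric.ball_mem_nhds c hr)).and
      (extChartAt_source_mem_nhds x)
  obtain ⟨y, hy, hyb, hys⟩ := ((mem_closure_iff_frequently.1 hx).and_eventually hnear).exists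
  set d := extChartAt 𝓗 x y with hddef
  have hdt : d ∈ (extChartAt 𝓗 x).target := (extChartAt 𝓗 x).map_source hys
  have hyd : (extChartAt 𝓗 x).symm d = y := (extChartAt 𝓗 x).left_inv hys
  have hloc : g =ᶠ[𝓝 d] id := by
    refine (hball d hyb).1.eventuallyEq_of_halfPlane analyticAt_id
      (im_nonneg_of_mem_target hdt) ?_
    have hs := (continuousAt_extChartAt_symm'' hdt).eventually (by rw [hyd]; exact hy)
    filter_upwards [hs, Metric.isOpen_ball.mem_nhds hyb] with z hz hzb h0
    obtain ⟨h1, h2, h3⟩ := (hball z hzb).2 h0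
    rw [hz] at h3
    exact ((extChartAt 𝓗 x).symm.injOn h1 h2 h3).symm
  have heq : EqOn g id (Metric.ball c r) :=
    AnalyticOnNhd.eqOn_of_preconnected_of_eventuallyEq (fun z hz => (hball z hz).1)
      (fun z _ => analyticAt_id) (convex_ball c r).isPreconnected hyb hloc
  refine eventually_of_extChartAt (p := fun y => φ y = id y) ?_
  filter_upwards [Metric.ball_mem_nhds c hr] with z hz h0
  rw [((hball z hz).2 h0).2.2, heq hz, id, id]

end Surface

namespace MarkedSurface

variable {r s : ℕ} {S : MarkedSurface r s}

/-! ### Automorphisms of the double -/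

theorem toDouble_inl_eq_inr {x : S.carrier} (hx : x ∈ S.bdry) :
    S.toDouble (Sum.inl x) = S.toDouble (Sum.inr x) :=
  Quot.sound (DoubleRel.glue x hx)

theorem fold_eq_of_toDouble_eq {p q : S.carrier ⊕ S.carrier} (h : S.toDouble p = S.toDouble q) :
    S.fold p = S.fold q := by
  have key : ∀ a b, S.DoubleRel a b → S.fold a = S.fold b := by
    rintro _ _ ⟨x, hx⟩
    rfl
  exact congrArg (Quot.lift S.fold key) h

theorem mem_bdry_of_toDouble_inl_eq_inr {x y : S.carrier}
    (h : S.toDouble (Sum.inl x) = S.toDouble (Sum.inr y)) : x ∈ S.bdry := by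
  -- the sheet `inl` without its boundary is saturated
  have key : ∀ a b, S.DoubleRel a b →
      (Sum.elim (fun x => x ∈ S.bdry) (fun _ => True) a) =
        (Sum.elim (fun x => x ∈ S.bdry) (fun _ => True) b) := by
    rintro _ _ ⟨x, hx⟩
    simpa using hx
  have := congrArg (Quot.lift _ key) h
  simpa [toDouble] using this

theorem SurfIso.mem_bdry_iff (φ : SurfIso S S) (x : S.carrier) :
    φ.toDiffeo x ∈ S.bdry ↔ x ∈ S.bdry :=
  φ.toDiffeo.mem_boundary_iff x

/-- The self-map of the double induced by an automorphism. -/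
noncomputable def SurfIso.doubleMap (φ : SurfIso S S) : S.Double → S.Double :=
  Quot.map (Sum.map φ.toDiffeo φ.toDiffeo) fun _ _ h => by
    obtain ⟨x, hx⟩ := h
    exact DoubleRel.glue _ ((φ.mem_bdry_iff x).2 hx)

theorem SurfIso.doubleMap_inl (φ : SurfIso S S) (x : S.carrier) :
    φ.doubleMap (S.toDouble (Sum.inl x)) = S.toDouble (Sum.inl (φ.toDiffeo x)) := rfl

theorem SurfIso.doubleMap_inr (φ : SurfIso S S) (x : S.carrier) :
    φ.doubleMap (S.toDouble (Sum.inr x)) = S.toDouble (Sum.inr (φ.toDiffeo x)) := rfl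

theorem SurfIso.continuous_doubleMap (φ : SurfIso S S) : Continuous φ.doubleMap :=
  continuous_quot_lift _ (continuous_quot_mk.comp
    (φ.toDiffeo.continuous.sumMap φ.toDiffeo.continuous))

/-- The homeomorphism of the double induced by an automorphism. -/
noncomputable def SurfIso.doubleHomeo (φ : SurfIso S S) : S.Double ≃ₜ S.Double where
  toFun := φ.doubleMap
  invFun := φ.symm.doubleMap
  left_inv := by
    rintro ⟨x | x⟩
    · exact congrArg (fun y => S.toDouble (Sum.inl y)) (φ.toDiffeo.symm_apply_apply x)
    · exact congrArg (fun y => S.toDouble (Sum.inr y)) (φ.toDiffeo.symm_apply_apply x)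
  right_inv := by
    rintro ⟨x | x⟩
    · exact congrArg (fun y => S.toDouble (Sum.inl y)) (φ.toDiffeo.apply_symm_apply x)
    · exact congrArg (fun y => S.toDouble (Sum.inr y)) (φ.toDiffeo.apply_symm_apply x)
  continuous_toFun := φ.continuous_doubleMap
  continuous_invFun := φ.symm.continuous_doubleMap

theorem doubleParam_of_nonneg (x : S.carrier) {w : ℂ} (hw : 0 ≤ w.im) :
    S.doubleParam x w = S.toDouble (Sum.inl ((extChartAt halfPlaneModel x).symm w)) :=
  if_pos hw

theorem doubleParam_of_neg (x : S.carrier) {w : ℂ} (hw : w.im < 0) :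
    S.doubleParam x w = S.toDouble (Sum.inr ((extChartAt halfPlaneModel x).symm (conj w))) :=
  if_neg hw.not_ge

/-- An automorphism induces a holomorphic map of the double: away from the boundary it is given by
its chart expression or the conjugate of it, and across the boundary by Schwarz reflection. -/
theorem SurfIso.doubleHolomorphic (φ : SurfIso S S) : S.DoubleHolomorphic φ.doubleMap := by
  intro p q hpq
  have hq : S.fold q = φ.toDiffeo (S.fold p) := by
    rcases p with x | x <;> exact (fold_eq_of_toDouble_eq hpq).symm
  rw [hq]
  obtain ⟨g, hg, hgc, hev⟩ := φ.toDiffeo.exists_analyticAt_extChartAt (S.fold p)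
  generalize hx : S.fold p = x at *
  set y := φ.toDiffeo x with hy
  set c := extChartAt halfPlaneModel x x with hcdef
  -- `g` preserves the interior of the half plane
  have hpos : ∀ᶠ z in 𝓝 c, 0 ≤ z.im → (0 < (g z).im ↔ 0 < z.im) := by
    filter_upwards [hev] with z hz h0
    obtain ⟨h1, h2, h3⟩ := hz h0
    rw [← isInteriorPoint_symm_iff h1, ← isInteriorPoint_symm_iff h2, ← h3,
      φ.toDiffeo.mem_interior_iff]
  have hnonneg : ∀ᶠ z in 𝓝 c, 0 ≤ z.im → 0 ≤ (g z).im := by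
    filter_upwards [hev] with z hz h0 using im_nonneg_of_mem_target (hz h0).2.1
  -- the upper sheet
  have hup : ∀ᶠ w in 𝓝 c, 0 ≤ w.im →
      φ.doubleMap (S.doubleParam x w) = S.doubleParam y (g w) := by
    filter_upwards [hev, hnonneg] with w h1 h2 h0
    rw [doubleParam_of_nonneg _ h0, doubleParam_of_nonneg _ (h2 h0), φ.doubleMap_inl,
      (h1 h0).2.2]
  -- the lower sheet
  have hdown : ∀ᶠ w in 𝓝 (conj c), w.im < 0 →
      φ.doubleMap (S.doubleParam x w) = S.doubleParam y (conj (g (conj w))) := by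
    have ht : Tendsto (fun w : ℂ => conj w) (𝓝 (conj c)) (𝓝 c) := by
      simpa using Complex.continuous_conj.tendsto (conj c)
    filter_upwards [ht.eventually hev, ht.eventually hpos] with w h1 h2 h0
    have h3 : 0 < (conj w).im := by simpa using h0
    have h4 : (conj (g (conj w))).im < 0 := by
      simpa only [Complex.conj_im, neg_lt_zero] using (h2 h3.le).2 h3
    rw [doubleParam_of_neg _ h0, doubleParam_of_neg _ h4, φ.doubleMap_inr, (h1 h3.le).2.2,
      Complex.conj_conj]
  by_cases hxb : x ∈ S.bdry
  · have hc : c.im = 0 := (mem_boundary_iff_im_eq_zero x).1 hxb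
    have hcc : conj c = c := Complex.conj_eq_iff_im.2 hc
    have hyb : conj (extChartAt halfPlaneModel y y) = extChartAt halfPlaneModel y y :=
      Complex.conj_eq_iff_im.2 ((mem_boundary_iff_im_eq_zero y).1 ((φ.mem_bdry_iff x).2 hxb))
    have hp : S.doubleCoord p = c := by
      rcases p with a | a <;> obtain rfl : a = x := hx
      · rfl
      · exact hcc
    have hqc : S.doubleCoord q = extChartAt halfPlaneModel y y := by
      rcases q with b | b <;> obtain rfl : b = y := hq
      · rfl
      · exact hyb
    rw [hp, hqc]
    refine ⟨g, hg, hgc, ?_⟩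
    have hrefl := hg.eventually_map_conj hc (by
      filter_upwards [hpos, hnonneg] with z h1 h2 h0
      have h3 := mt (h1 h0.ge).1 h0.le.not_gt
      exact le_antisymm (not_lt.1 h3) (h2 h0.ge))
    rw [hcc] at hdown
    filter_upwards [hup, hdown, hrefl] with w h1 h2 h3
    rcases le_or_gt 0 w.im with h0 | h0
    · exact h1 h0
    · rw [h3]
      exact h2 h0
  · have hc : 0 < c.im := by
      rw [← mem_interior_iff_im_pos, ← ModelWithCorners.compl_boundary]
      exact hxb
    rcases p with a | a <;> obtain rfl : a = x := hx
    · rcases q with b | b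
      · obtain rfl : b = y := hq
        refine ⟨g, hg, hgc, ?_⟩
        filter_upwards [hup, (isOpen_lt continuous_const Complex.continuous_im).mem_nhds hc]
          with w h1 h0 using h1 (le_of_lt h0)
      · exact absurd ((φ.mem_bdry_iff a).1 (mem_bdry_of_toDouble_inl_eq_inr hpq)) hxb
    · rcases q with b | b
      · obtain rfl : b = y := hq
        exact absurd ((φ.mem_bdry_iff a).1 (mem_bdry_of_toDouble_inl_eq_inr hpq.symm)) hxb
      · obtain rfl : b = y := hq
        have hgconj : AnalyticAt ℂ (fun w => conj (g (conj w))) (conj c) :=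
          AnalyticAt.conj_conj (by rwa [Complex.conj_conj])
        have hneg : (conj c).im < 0 := by simpa using hc
        refine ⟨_, hgconj, ?_, ?_⟩
        · change conj (g (conj (conj c))) = conj _
          rw [Complex.conj_conj, hgc]
        · filter_upwards [hdown,
            (isOpen_lt Complex.continuous_im continuous_const).mem_nhds hneg]
            with w h1 h0 using h1 h0

theorem SurfIso.map_doubleNodes (φ : SurfIso S S) :
    Sym2.map φ.doubleHomeo '' S.doubleNodes = S.doubleNodes := by
  have hnodes : Sym2.map φ.toDiffeo '' S.nodes = S.nodes := by
    ext e
    constructor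
    · rintro ⟨e, he, rfl⟩
      exact (φ.map_nodes e).2 he
    · intro he
      refine ⟨Sym2.map φ.symm.toDiffeo e, (φ.symm.map_nodes e).2 he, ?_⟩
      rw [Sym2.map_map]
      have : (φ.toDiffeo ∘ φ.symm.toDiffeo : S.carrier → S.carrier) = id :=
        funext φ.toDiffeo.apply_symm_apply
      rw [this, Sym2.map_id, id]
  unfold doubleNodes
  conv_rhs => rw [← hnodes]
  rw [image_image, image_image]
  simp only [Sym2.map_map]
  rfl

theorem SurfIso.doubleHomeo_mem_doubleAut (φ : SurfIso S S) : φ.doubleHomeo ∈ S.doubleAut :=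
  ⟨φ.doubleHolomorphic, φ.symm.doubleHolomorphic, φ.map_doubleNodes,
    fun i => congrArg (fun x => S.toDouble (Sum.inl x)) (φ.map_bdryPt i),
    fun j => congrArg (fun x => S.toDouble (Sum.inl x)) (φ.map_intPt j),
    fun j => congrArg (fun x => S.toDouble (Sum.inr x)) (φ.map_intPt j)⟩

theorem SurfIso.doubleHomeo_injective :
    Function.Injective (SurfIso.doubleHomeo : SurfIso S S → S.Double ≃ₜ S.Double) :=
  fun _ _ h => SurfIso.ext_fun fun x =>
    fold_eq_of_toDouble_eq (congrArg (fun f : S.Double ≃ₜ S.Double => f (S.toDouble (Sum.inl x))) h)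

theorem Stable.finite_surfIso (hS : S.Stable) : Finite (SurfIso S S) :=
  have : Finite S.doubleAut := hS.to_subtype
  Finite.of_injective (fun φ : SurfIso S S => (⟨_, φ.doubleHomeo_mem_doubleAut⟩ : S.doubleAut))
    fun _ _ h => SurfIso.doubleHomeo_injective (congrArg Subtype.val h)

/-- Every automorphism of a stable surface has finite order. -/
theorem Stable.exists_iterate_eq_id (hS : S.Stable) (φ : SurfIso S S) :
    ∃ n ≠ 0, φ.toDiffeo^[n] = id := by
  have := hS.finite_surfIso
  let pow : ℕ → SurfIso S S := fun n => Nat.rec (SurfIso.refl S) (fun _ ψ => ψ.trans φ) n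
  have hpow : ∀ n, ((pow n).toDiffeo : S.carrier → S.carrier) = φ.toDiffeo^[n] := by
    intro n
    induction n with
    | zero => rfl
    | succ n ih =>
      rw [Function.iterate_succ', ← ih]
      rfl
  obtain ⟨m, n, hmn, h⟩ := Finite.exists_ne_map_eq_of_infinite pow
  wlog hlt : m < n generalizing m n
  · exact this n m hmn.symm h.symm (lt_of_le_of_ne (not_lt.1 hlt) hmn.symm)
  refine ⟨n - m, (Nat.sub_pos_of_lt hlt).ne', funext fun x => ?_⟩
  refine φ.toDiffeo.injective.iterate m ?_
  change φ.toDiffeo^[m] (φ.toDiffeo^[n - m] x) = φ.toDiffeo^[m] x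
  rw [← Function.iterate_add_apply, Nat.add_sub_cancel' hlt.le, ← hpow n, ← h, hpow m]

/-! ### Rigidity -/

/-- A nonempty clopen set of the normalization that contains both points over a node whenever it
contains one is everything: its image in the connected nodal surface is clopen. -/
theorem eq_univ_of_isClopen {A : Set S.carrier} (hA : IsClopen A)
    (hnode : ∀ x y, s(x, y) ∈ S.nodes → x ∈ A → y ∈ A) (hne : A.Nonempty) : A = univ := by
  have := S.connected
  let B : Set S.Space := {p | Quot.lift (fun x => x ∈ A) (fun x y h => propext
    ⟨hnode x y h, hnode y x (by rwa [Sym2.eq_swap])⟩) p}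
  have hB : IsClopen B := isQuotientMap_quot_mk.isClopen_preimage.1 hA
  obtain ⟨x, hx⟩ := hne
  have hBu : B = univ := hB.eq_univ ⟨S.toSpace x, hx⟩
  exact eq_univ_of_forall fun y => (hBu ▸ mem_univ (S.toSpace y) : S.toSpace y ∈ B)

/-- If an automorphism fixes one of the two points over a node, it fixes the other. -/
theorem SurfIso.apply_eq_of_node (φ : SurfIso S S) {x y : S.carrier} (h : s(x, y) ∈ S.nodes)
    (hx : φ.toDiffeo x = x) : φ.toDiffeo y = y := by
  have h1 : s(x, φ.toDiffeo y) ∈ S.nodes := by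
    have := (φ.map_nodes s(x, y)).2 h
    rwa [Sym2.map_mk, hx] at this
  exact Sym2.congr_right.1
    (S.nodes_disjoint _ h1 _ h x (Sym2.mem_mk_left _ _) (Sym2.mem_mk_left _ _))

theorem Stable.eq_refl (hS : S.Stable) (hr : 1 ≤ r) (φ : SurfIso S S) : φ = SurfIso.refl S := by
  obtain ⟨n, hn, hφ⟩ := hS.exists_iterate_eq_id φ
  have huniv : {x | φ.toDiffeo =ᶠ[𝓝 x] id} = univ := by
    refine eq_univ_of_isClopen φ.toDiffeo.isClopen_eventuallyEq_id (fun x y hxy hx => ?_) ?_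
    · exact φ.toDiffeo.eventuallyEq_id_of_iterate hn hφ
        (S.nodes_boundary _ hxy y (Sym2.mem_mk_right _ _)) (φ.apply_eq_of_node hxy hx.self_of_nhds)
    · exact ⟨S.bdryPt ⟨0, hr⟩, φ.toDiffeo.eventuallyEq_id_of_iterate hn hφ (S.bdryPt_mem _)
        (φ.map_bdryPt _)⟩
  refine SurfIso.ext_fun fun x => ?_
  have hx : x ∈ {x | φ.toDiffeo =ᶠ[𝓝 x] id} := huniv ▸ mem_univ x
  exact hx.self_of_nhds

/-! ### Families without automorphisms -/

theorem Family.subsingleton_hom {T : Type} [TopologicalSpace T] {P : MarkedSurface r s → Prop}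
    (hP : ∀ S, P S → ∀ φ : SurfIso S S, φ = SurfIso.refl S) (F G : Family T P) :
    Subsingleton (F ⟶ G) := by
  refine ⟨fun φ ψ => FamilyIso.ext_onFib fun t => SurfIso.ext_fun fun x => ?_⟩
  let φt : SurfIso (F.fib t) (G.fib t) := FamilyIso.onFib φ t
  let ψt : SurfIso (F.fib t) (G.fib t) := FamilyIso.onFib ψ t
  have h := hP _ (F.fib_mem t) (φt.trans ψt.symm)
  have hx : ψt.toDiffeo.symm (φt.toDiffeo x) = x :=
    congrArg (fun χ : SurfIso (F.fib t) (F.fib t) => χ.toDiffeo x) h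
  change φt.toDiffeo x = ψt.toDiffeo x
  rw [← ψt.toDiffeo.apply_symm_apply (φt.toDiffeo x), hx]

end MarkedSurface

theorem toIsoClasses_isEquivalence (C : Type*) [Groupoid C]
    (hC : ∀ X Y : C, Subsingleton (X ⟶ Y)) : (toIsoClasses C).IsEquivalence where
  faithful := ⟨fun {X Y} _ _ _ => (hC X Y).elim _ _⟩
  full := ⟨fun {X Y} f => by
    obtain ⟨i⟩ : IsIsomorphic X Y := Quotient.exact (Discrete.eq_of_hom f)
    exact ⟨i.hom, Subsingleton.elim _ _⟩⟩
  essSurj := ⟨fun ⟨q⟩ => by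
    obtain ⟨X, rfl⟩ := Quotient.exists_rep q
    exact ⟨X, ⟨Iso.refl _⟩⟩⟩

theorem mainTheorem4 (g h r s : ℕ) (hh : 0 < h) (hr : 1 ≤ r) :
    (∀ S : MarkedSurface r s, S.InNbar g h →
      ∀ φ : MarkedSurface.SurfIso S S, φ = MarkedSurface.SurfIso.refl S) ∧
    (∀ (T : Type) [TopologicalSpace T],
      (toIsoClasses (MarkedSurface.Nbar g h r s T)).IsEquivalence) ∧
    (∀ (T : Type) [TopologicalSpace T],
      (toIsoClasses (MarkedSurface.DSpace g h r s T)).IsEquivalence) :=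
  ⟨fun _ hS φ => hS.1.eq_refl hr φ,
    fun _ _ => toIsoClasses_isEquivalence _
      (MarkedSurface.Family.subsingleton_hom fun _ hS φ => hS.1.eq_refl hr φ),
    fun _ _ => toIsoClasses_isEquivalence _
      (MarkedSurface.Family.subsingleton_hom fun _ hS φ => hS.1.1.eq_refl hr φ)⟩
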